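/- Let $\mathfrak D_{2n}$ ($n\ge 0$) be the set of D-permutations of $[2n]$, i.e. permutations $\sigma$ with $\sigma(i)\ge i$ for every odd $i$ and $\sigma(i)\le i$ for every even $i$. Let $\mathrm{evenfix}(\sigma)$ and $\mathrm{oddfix}(\sigma)$ be the numbers of even and odd fixed points of $\sigma$. A labelled 0-Schröder path of length $2n$ is a pair $(\omega,\xi)$, where $\omega$ is a lattice path from $(0,0)$ to $(2n,0)$ that never goes below height $0$, with steps $(1,1)$ (rise), $(1,-1)$ (fall) and $(2,0)$ (long level step, allowed at height $0$ only), and where step $s_i$ (the step starting at abscissa $i-1$), if its starting height is $h$, carries a label $\xi_i\in\{0,\dots,\lceil h/2\rceil\}$ if it is a rise, $\xi_i\in\{0,\dots,\lceil (h-1)/2\rceil\}$ if it is a fall, and $\xi_i=0$ if it is a long level step. Let $\mathfrak{DS}_{2n}$ be the set of these labelled paths. The Deb–Sokal map $\varphi_{2n}$ sends $\sigma\in\mathfrak D_{2n}$ to the following labelled path. Take the path from $(0,0)$ whose $i$-th step is a rise if $\sigma^{-1}(i)$ is even and a fall if $\sigma^{-1}(i)$ is odd, and replace each fall from height $0$ together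 with the rise from height $-1$ that follows it by one long level step with label $0$. Every other step $i$ gets the label $\xi_i=\#\{j:\sigma(j)<\sigma(i)\le i<j\}$ if $i$ is even and $\xi_i=\#\{j: j<i\le\sigma(i)<\sigma(j)\}$ if $i$ is odd. Let $\phi_{2n}(\omega,\xi)=(\omega,\xi^{\mathrm c})$ where, for a step $s_i$ with starting height $h$: if $s_i$ is a rise and $i$ is odd, $\xi_i^{\mathrm c}=\lceil h/2\rceil-\xi_i$; if $s_i$ is a rise and $i$ is even, $\xi_i^{\mathrm c}=\lceil h/2\rceil-1-\xi_i$ when $\xi_i<\lceil h/2\rceil$ and $\xi_i^{\mathrm c}=\xi_i$ when $\xi_i=\lceil h/2\rceil$; if $s_i$ is a fall and $i$ is even, $\xi_i^{\mathrm c}=\lceil (h-1)/2\rceil-\xi_i$; if $s_i$ is a fall and $i$ is odd, $\xi_i^{\mathrm c}=\lceil (h-1)/2\rceil-1-\xi_i$ when $\xi_i<\lceil (h-1)/2\rceil$ and $\xi_i^{\mathrm c}=\xi_i$ when $\xi_i=\lceil (h-1)/2\rceil$; if $s_i$ is a long level step, $\xi_i^{\mathrm c}=\xi_i=0$. Then: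 1. For every $n\ge0$, $\varphi_{2n}$ is a bijection from $\mathfrak D_{2n}$ onto $\mathfrak{DS}_{2n}$. 2. For every $n\ge0$, $\phi_{2n}$ is an involution on $\mathfrak{DS}_{2n}$, and $(\omega,\xi)\in\mathfrak{DS}_{2n}$ is fixed by $\phi_{2n}$ if and only if $\omega$ does not go above height $2$. 3. For every $n\ge0$, the Genocchi–Corteel map $\phi^{\mathrm{GC}}_{2n}=\varphi_{2n}^{-1}\circ\phi_{2n}\circ\varphi_{2n}$ is an involution on $\mathfrak D_{2n}$. 4. Let $$P_n(w_{\mathrm e},w_{\mathrm o})=\sum_{\sigma\in\mathfrak D_{2n},\ \phi^{\mathrm{GC}}_{2n}(\sigma)=\sigma} w_{\mathrm e}^{\mathrm{evenfix}(\sigma)}\,w_{\mathrm o}^{\mathrm{oddfix}(\sigma)}.$$ Then, as formal power series in $t$ over $\mathbb Z[w_{\mathrm e},w_{\mathrm o}]$, $$\sum_{n=0}^\infty P_n(w_{\mathrm e},w_{\mathrm o})\,t^n=\dfrac{1}{1-w_{\mathrm e}w_{\mathrm o}t-\dfrac{t}{1-(1+w_{\mathrm e})(1+w_{\mathrm o})t}}.$$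 -/

import Mathlib

open scoped PowerSeries

namespace GenocchiCorteel

/-! ### D-permutations

A permutation of `[2n] = {1, …, 2n}` is an `Equiv.Perm (Fin (2 * n))`; the element `i : Fin (2 * n)`
stands for the letter `i + 1`. -/

/-- A D-permutation of `[2n]`: every odd letter satisfies `i ≤ σ(i)` and every even letter satisfies
`σ(i) ≤ i`. -/
def IsDPerm {n : ℕ} (σ : Equiv.Perm (Fin (2 * n))) : Prop :=
  ∀ i : Fin (2 * n), (Odd ((i : ℕ) + 1) → i ≤ σ i) ∧ (Even ((i : ℕ) + 1) → σ i ≤ i)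

/-- The set of D-permutations of `[2n]`. -/
def DPerms (n : ℕ) : Set (Equiv.Perm (Fin (2 * n))) := {σ | IsDPerm σ}

/-- The number of even fixed points. -/
def evenFix {n : ℕ} (σ : Equiv.Perm (Fin (2 * n))) : ℕ :=
  (Finset.univ.filter fun i : Fin (2 * n) => Even ((i : ℕ) + 1) ∧ σ i = i).card

/-- The number of odd fixed points. -/
def oddFix {n : ℕ} (σ : Equiv.Perm (Fin (2 * n))) : ℕ :=
  (Finset.univ.filter fun i : Fin (2 * n) => Odd ((i : ℕ) + 1) ∧ σ i = i).card

/-! ### Labelled Schröder paths -/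

/-- The steps of a Schröder path: rise `(1, 1)`, fall `(1, -1)`, long level step `(2, 0)`. -/
inductive Step where
  | rise : Step
  | fall : Step
  | level : Step

/-- Horizontal extent of a step. -/
def Step.width : Step → ℕ
  | .rise => 1
  | .fall => 1
  | .level => 2

/-- Height after a step that starts at height `h`. (A fall never starts at height `0`, see
`IsLabelledFrom`.) -/
def Step.next (h : ℕ) : Step → ℕ
  | .rise => h + 1
  | .fall => h - 1
  | .level => h

/-- A sequence of steps, each with its label. -/
abbrev LabelledSteps := List (Step × ℕ)

/-- Total horizontal extent. -/
def pathLength (p : LabelledSteps) : ℕ := (p.map fun s => s.1.width).sum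

/-- Starting at height `h`, the steps stay at height `≥ 0` and end at height `0`, and the label of
each rise (fall, long level step) starting at height `k` lies in `A k` (`B k`, `C k`). -/
def IsLabelledFrom (A B C : ℕ → Set ℕ) : ℕ → LabelledSteps → Prop
  | h, [] => h = 0
  | h, (.rise, x) :: p => x ∈ A h ∧ IsLabelledFrom A B C (h + 1) p
  | h, (.fall, x) :: p => 1 ≤ h ∧ x ∈ B h ∧ IsLabelledFrom A B C (h - 1) p
  | h, (.level, x) :: p => x ∈ C h ∧ IsLabelledFrom A B C h p

/-- The `(A, B, C)`-labelled Schröder paths of length `m`. -/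
def labelledSchroderPaths (A B C : ℕ → Set ℕ) (m : ℕ) : Set LabelledSteps :=
  {p | pathLength p = m ∧ IsLabelledFrom A B C 0 p}

/-- Labels of rises: `{0, …, ⌈h/2⌉}`. -/
def labelA (h : ℕ) : Set ℕ := {x | x ≤ h ⌈/⌉ 2}

/-- Labels of falls: `{0, …, ⌈(h-1)/2⌉}` (used for `h ≥ 1` only). -/
def labelB (h : ℕ) : Set ℕ := {x | x ≤ (h - 1) ⌈/⌉ 2}

/-- Labels of long level steps: `{0}` at height `0` and none at positive height, so that long level
steps occur at height `0` only. -/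
def labelC (h : ℕ) : Set ℕ := {x | h = 0 ∧ x = 0}

/-- The labelled 0-Schröder paths of length `2n` that correspond to D-permutations of `[2n]`. -/
def DSPaths (n : ℕ) : Set LabelledSteps := labelledSchroderPaths labelA labelB labelC (2 * n)

/-- The largest height reached by a path starting at height `h`. -/
def maxHeightFrom : ℕ → LabelledSteps → ℕ
  | h, [] => h
  | h, s :: p => max h (maxHeightFrom (s.1.next h) p)

/-- The height of a path. -/
def pathHeight (p : LabelledSteps) : ℕ := maxHeightFrom 0 p

/-! ### The involution on labelled paths -/

/-- The label that replaces the label `x` of step number `i` when that step starts at height `h`. -/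
def compLabel (i h : ℕ) (x : ℕ) : Step → ℕ
  | .rise =>
      if Even i then (if x = h ⌈/⌉ 2 then x else h ⌈/⌉ 2 - 1 - x)
      else h ⌈/⌉ 2 - x
  | .fall =>
      if Even i then (h - 1) ⌈/⌉ 2 - x
      else (if x = (h - 1) ⌈/⌉ 2 then x else (h - 1) ⌈/⌉ 2 - 1 - x)
  | .level => x

/-- Replace all labels; the first step has number `i` and starts at height `h`. The number of a step
is one more than the abscissa at which it starts. -/
def complementFrom : ℕ → ℕ → LabelledSteps → LabelledSteps
  | _, _, [] => []
  | i, h, (s, x) :: p => (s, compLabel i h x s) :: complementFrom (i + s.width) (s.next h) p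

/-- The map `(ω, ξ) ↦ (ω, ξᶜ)`. -/
def complement (p : LabelledSteps) : LabelledSteps := complementFrom 1 0 p

/-! ### The first Deb–Sokal bijection -/

/-- Height at abscissa `k` of the almost-Dyck path of `σ`, whose step number `j` is a rise if
`σ⁻¹(j)` is even and a fall if `σ⁻¹(j)` is odd. -/
def almostDyckHeight {n : ℕ} (σ : Equiv.Perm (Fin (2 * n))) (k : ℕ) : ℤ :=
  ∑ j ∈ Finset.univ.filter (fun j : Fin (2 * n) => (j : ℕ) < k),
    if Even ((σ.symm j : ℕ) + 1) then 1 else -1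

/-- The label of the letter `i`: its number of (lower, resp. upper) nestings. -/
def nestLabel {n : ℕ} (σ : Equiv.Perm (Fin (2 * n))) (i : Fin (2 * n)) : ℕ :=
  if Even ((i : ℕ) + 1) then
    (Finset.univ.filter fun j : Fin (2 * n) => σ j < σ i ∧ σ i ≤ i ∧ i < j).card
  else
    (Finset.univ.filter fun j : Fin (2 * n) => j < i ∧ i ≤ σ i ∧ σ i < σ j).card

/-- The contribution of the letter `i` to the labelled 0-Schröder path. A fall from height `0` of the
almost-Dyck path and the rise from height `-1` after it are replaced by one long level step, with
label `0`; all other steps are kept and are labelled by `nestLabel`. -/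
def dsStep {n : ℕ} (σ : Equiv.Perm (Fin (2 * n))) (i : Fin (2 * n)) : Option (Step × ℕ) :=
  if almostDyckHeight σ i < 0 then none
  else if Even ((σ.symm i : ℕ) + 1) then some (.rise, nestLabel σ i)
  else if almostDyckHeight σ i = 0 then some (.level, 0)
  else some (.fall, nestLabel σ i)

/-- The Deb–Sokal map from permutations to labelled paths (relevant on D-permutations). -/
def dsMap {n : ℕ} (σ : Equiv.Perm (Fin (2 * n))) : LabelledSteps :=
  (List.finRange (2 * n)).filterMap (dsStep σ)

/-! ### The Genocchi–Corteel involution and its fixed points -/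

/-- The Genocchi–Corteel involution: `complement` conjugated by the bijection `dsMap` between
`DPerms n` and `DSPaths n`. -/
noncomputable def gc {n : ℕ} (σ : Equiv.Perm (Fin (2 * n))) : Equiv.Perm (Fin (2 * n)) :=
  Function.invFunOn dsMap (DPerms n) (complement (dsMap σ))

open Classical in
/-- The D-permutations of `[2n]` fixed by the Genocchi–Corteel involution. -/
noncomputable def gcFixed (n : ℕ) : Finset (Equiv.Perm (Fin (2 * n))) :=
  Finset.univ.filter fun σ => σ ∈ DPerms n ∧ gc σ = σ

/-- The variable `w_e`. -/
noncomputable def wₑ : MvPolynomial (Fin 2) ℤ := MvPolynomial.X 0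

/-- The variable `w_o`. -/
noncomputable def wₒ : MvPolynomial (Fin 2) ℤ := MvPolynomial.X 1

/-- The polynomial counting even and odd fixed points of the permutations in `gcFixed n`. -/
noncomputable def gcPoly (n : ℕ) : MvPolynomial (Fin 2) ℤ :=
  ∑ σ ∈ gcFixed n, wₑ ^ evenFix σ * wₒ ^ oddFix σ

/-- The inverse of a power series with constant coefficient `1`. -/
noncomputable def recip {R : Type*} [CommRing R] (f : R⟦X⟧) : R⟦X⟧ := PowerSeries.invOfUnit f 1

/-- `recip f` is the multiplicative inverse of `f` when `f` has constant coefficient `1`. -/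
theorem mul_recip {R : Type*} [CommRing R] (f : R⟦X⟧) (hf : PowerSeries.constantCoeff f = 1) :
    f * recip f = 1 :=
  PowerSeries.mul_invOfUnit f 1 (by simpa using hf)

end GenocchiCorteel

/-!
The labels of a D-permutation on the even letters are the entries of the inversion code of the
bijection that it induces from the even letters to the rises of its almost-Dyck path, and likewise
for the odd letters and the falls, with the order reversed. Such a bijection is determined by its
code, and it moves no letter upwards exactly if the code stays below a bound given by the numbers of
rises and of even letters up to the current letter, that is, by the height of the path. A letter is
a fixed point if and only if its label attains this bound before rounding.

The label complement acts on the labels of each step by an involution. Since the abscissa and the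
height of a path have the same parity, every label is unchanged by it on the steps between the
heights `0`, `1` and `2`, whereas no label of a rise from height `2` is. A fixed path has therefore
height at most `2`, and splitting off its first step gives two linear equations for the generating
functions of such paths that start at height `0` and at height `1`, in which even and odd fixed
points are counted by the labels that attain their bound.
-/

namespace GenocchiCorteel

open Finset

/-! ### Inversion codes of bijections between finite sets -/

section InversionCode

theorem card_filter_comp_of_bijOn {α β : Type*} {P : Finset α} {V : Finset β} {f : α → β}
    (hf : Set.BijOn f P V) (r : β → Prop) [DecidablePred r] :
    #{q ∈ P | r (f q)} = #{v ∈ V | r v} := by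
  classical
  obtain rfl : P.image f = V := by exact_mod_cast hf.image_eq
  rw [filter_image, card_image_of_injOn]
  exact hf.injOn.mono (mod_cast filter_subset _ P)

variable {α β : Type*} [LinearOrder α] [LinearOrder β]

theorem strictMonoOn_card_filter_lt (V : Finset α) :
    StrictMonoOn (fun v => #{u ∈ V | u < v}) V := fun a ha b _ hab =>
  card_lt_card <| ssubset_iff_of_subset
    (monotone_filter_right V fun _ _ hu => hu.trans hab) |>.2 ⟨a, by simp_all, by simp⟩

theorem exists_mem_card_filter_lt_eq (V : Finset α) {k : ℕ} (hk : k < #V) :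
    ∃ v ∈ V, #{u ∈ V | u < v} = k := by
  have hsurj : Set.SurjOn (fun v => #{u ∈ V | u < v}) V (range #V) :=
    surjOn_of_injOn_of_card_le _
      (fun v hv => mem_coe.2 <| mem_range.2 <|
        card_lt_card (filter_ssubset.2 ⟨v, hv, lt_irrefl v⟩))
      (strictMonoOn_card_filter_lt V).injOn (by simp)
  exact hsurj (by simpa using hk)

theorem exists_mem_le_card_filter_lt_eq (V : Finset α) (a : α) {k : ℕ}
    (hk : k < #{v ∈ V | v ≤ a}) : ∃ v ∈ V, v ≤ a ∧ #{u ∈ V | u < v} = k := by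
  obtain ⟨v, hv, hvk⟩ := exists_mem_card_filter_lt_eq {v ∈ V | v ≤ a} hk
  obtain ⟨hvV, hva⟩ := mem_filter.1 hv
  refine ⟨v, hvV, hva, hvk ▸ ?_⟩
  rw [filter_filter]
  congr 1
  exact filter_congr fun u _ => ⟨fun h => ⟨h.le.trans hva, h⟩, And.right⟩

/-- The entry at `p` of the (right) inversion code of `f` on `P`, i.e. of its Lehmer code. On the
even letters of a D-permutation it is the number of lower nestings. -/
def rightInversions (P : Finset α) (f : α → β) (p : α) : ℕ := #{q ∈ P | p < q ∧ f q < f p}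

/-- The entry at `p` of the left inversion code of `f` on `P`; it is `rightInversions` for the
reversed orders. On the odd letters of a D-permutation it is the number of upper nestings. -/
def leftInversions (P : Finset α) (f : α → β) (p : α) : ℕ := #{q ∈ P | q < p ∧ f p < f q}

theorem rightInversions_congr {P : Finset α} {f g : α → β} {p : α} (hfg : Set.EqOn f g P)
    (hp : p ∈ P) : rightInversions P f p = rightInversions P g p := by
  unfold rightInversions
  congr 1
  exact filter_congr fun q hq => by rw [hfg hp, hfg hq]

theorem leftInversions_congr {P : Finset α} {f g : α → β} {p : α} (hfg : Set.EqOn f g P)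
    (hp : p ∈ P) : leftInversions P f p = leftInversions P g p :=
  rightInversions_congr (α := αᵒᵈ) (β := βᵒᵈ) hfg hp

theorem rightInversions_insert_self {s : Finset α} {V : Finset β} {f : α → β} {a : α}
    (ha : ∀ q ∈ s, a < q) (hf : Set.BijOn f (insert a s : Finset α) V) :
    rightInversions (insert a s) f a = #{v ∈ V | v < f a} := by
  rw [← card_filter_comp_of_bijOn hf (· < f a), rightInversions]
  congr 1
  refine filter_congr fun q hq => ?_
  rcases mem_insert.1 hq with rfl | hq
  · simp
  · simp [ha q hq]

theorem rightInversions_insert_of_mem {s : Finset α} {f : α → β} {a p : α}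
    (ha : ∀ q ∈ s, a < q) (hp : p ∈ s) :
    rightInversions (insert a s) f p = rightInversions s f p := by
  rw [rightInversions, filter_insert, if_neg fun h => (ha p hp).not_gt h.1, rightInversions]

theorem eqOn_of_rightInversions_eq {P : Finset α} {V : Finset β} {f g : α → β}
    (hf : Set.BijOn f P V) (hg : Set.BijOn g P V)
    (hfg : ∀ p ∈ P, rightInversions P f p = rightInversions P g p) : Set.EqOn f g P := by
  induction P using Finset.induction_on_min generalizing V with
  | empty => simp
  | insert a s ha ih =>
    have has : a ∉ s := fun h => lt_irrefl a (ha a h)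
    have hmem : a ∈ insert a s := mem_insert_self a s
    have hfa : f a = g a := by
      refine (strictMonoOn_card_filter_lt V).injOn (hf.mapsTo hmem) (hg.mapsTo hmem) ?_
      simpa only [rightInversions_insert_self ha hf, rightInversions_insert_self ha hg]
        using hfg a hmem
    have hrest {k : α → β} (hk : Set.BijOn k (insert a s : Finset α) V) :
        Set.BijOn k s (V.erase (k a)) := by
      simpa [has] using hk.sdiff_singleton (a := a) hmem
    have hs : Set.EqOn f g s := ih (hrest hf) (hfa ▸ hrest hg) fun p hp => by
      simpa only [rightInversions_insert_of_mem ha hp] using hfg p (mem_insert_of_mem hp)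
    intro p hp
    rcases mem_insert.1 hp with rfl | hp
    exacts [hfa, hs hp]

theorem eqOn_of_leftInversions_eq {P : Finset α} {V : Finset β} {f g : α → β}
    (hf : Set.BijOn f P V) (hg : Set.BijOn g P V)
    (hfg : ∀ p ∈ P, leftInversions P f p = leftInversions P g p) : Set.EqOn f g P :=
  eqOn_of_rightInversions_eq (α := αᵒᵈ) (β := βᵒᵈ) hf hg hfg

theorem exists_bijOn_rightInversions_eq (P V : Finset α) (c : α → ℕ) (hcard : #P = #V)
    (hc : ∀ p ∈ P, c p + #{q ∈ P | q < p} < #{v ∈ V | v ≤ p}) :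
    ∃ f : α → α, Set.BijOn f P V ∧ ∀ p ∈ P, f p ≤ p ∧ rightInversions P f p = c p := by
  induction P using Finset.induction_on_min generalizing V with
  | empty =>
    obtain rfl : V = ∅ := by simpa using hcard.symm
    exact ⟨id, by simp, by simp⟩
  | insert a s ha ih =>
    have has : a ∉ s := fun h => lt_irrefl a (ha a h)
    -- The minimum `a` precedes all other elements, so its code entry is the rank of its image.
    obtain ⟨v, hvV, hva, hvc⟩ := exists_mem_le_card_filter_lt_eq V a
      ((Nat.le_add_right _ _).trans_lt (hc a (mem_insert_self a s)))
    obtain ⟨g, hg, hgc⟩ := ih (V.erase v) (by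
      rw [card_insert_of_notMem has] at hcard
      rw [card_erase_of_mem hvV]
      lia) fun p hp => by
      have hcp := hc p (mem_insert_of_mem hp)
      rw [filter_insert, if_pos (ha p hp), card_insert_of_notMem (by simp [has])] at hcp
      rw [filter_erase, card_erase_of_mem (by simp [hvV, hva.trans (ha p hp).le])]
      lia
    set f := Function.update g a v with hf_def
    have hfa : f a = v := Function.update_self a v g
    have hfs : Set.EqOn f g s := fun p hp =>
      Function.update_of_ne (fun h : p = a => has (h ▸ hp)) v g
    have hf : Set.BijOn f (insert a s : Finset α) V := by
      have h := (hfs.bijOn_iff.2 hg).insert (a := a) (by simp [hfa])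
      rwa [hfa, ← coe_insert, ← coe_insert, insert_erase hvV] at h
    refine ⟨f, hf, fun p hp => ?_⟩
    rcases mem_insert.1 hp with rfl | hp
    · exact ⟨hfa.trans_le hva, by rw [rightInversions_insert_self ha hf, hfa, hvc]⟩
    · rw [hfs hp, rightInversions_insert_of_mem ha hp, rightInversions_congr hfs hp]
      exact hgc p hp

theorem exists_bijOn_leftInversions_eq (P V : Finset α) (c : α → ℕ) (hcard : #P = #V)
    (hc : ∀ p ∈ P, c p + #{q ∈ P | p < q} < #{v ∈ V | p ≤ v}) :
    ∃ f : α → α, Set.BijOn f P V ∧ ∀ p ∈ P, p ≤ f p ∧ leftInversions P f p = c p :=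
  exists_bijOn_rightInversions_eq (α := αᵒᵈ) P V c hcard hc

variable {P V : Finset α} {f : α → α} {p : α}

theorem card_filter_le_eq_rightInversions_add (hf : Set.BijOn f P V) (hle : ∀ q ∈ P, f q ≤ q)
    (hp : p ∈ P) :
    #{v ∈ V | v ≤ p} = rightInversions P f p + #{q ∈ P | q < p} + 1 +
      #{q ∈ P | p < q ∧ f p < f q ∧ f q ≤ p} := by
  have hone : 1 = #{q ∈ P | q = p} := by simp [filter_eq', hp]
  rw [← card_filter_comp_of_bijOn hf (· ≤ p), rightInversions, hone]
  simp only [card_filter, ← sum_add_distrib]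
  refine sum_congr rfl fun q hq => ?_
  have hfq := hle q hq
  have hfp := hle p hp
  rcases lt_trichotomy q p with hqp | rfl | hpq
  · simp [hqp, hqp.ne, hqp.not_gt, hfq.trans hqp.le]
  · simp [hfq]
  · have hne : f q ≠ f p := fun h => hpq.ne' (hf.injOn hq hp h)
    rcases hne.lt_or_gt with hlt | hgt
    · simp [hpq, hpq.ne', hpq.not_gt, hlt, hlt.not_gt, hlt.le.trans hfp]
    · simp [hpq, hpq.ne', hpq.not_gt, hgt, hgt.not_gt]

theorem rightInversions_add_card_lt (hf : Set.BijOn f P V) (hle : ∀ q ∈ P, f q ≤ q)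
    (hp : p ∈ P) : rightInversions P f p + #{q ∈ P | q < p} < #{v ∈ V | v ≤ p} := by
  have := card_filter_le_eq_rightInversions_add hf hle hp
  lia

theorem leftInversions_add_card_lt (hf : Set.BijOn f P V) (hle : ∀ q ∈ P, q ≤ f q)
    (hp : p ∈ P) : leftInversions P f p + #{q ∈ P | p < q} < #{v ∈ V | p ≤ v} :=
  rightInversions_add_card_lt (α := αᵒᵈ) hf hle hp

theorem apply_eq_self_iff_rightInversions (hf : Set.BijOn f P V) (hle : ∀ q ∈ P, f q ≤ q)
    (hp : p ∈ P) :
    f p = p ↔ p ∈ V ∧ rightInversions P f p + #{q ∈ P | q < p} + 1 = #{v ∈ V | v ≤ p} := by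
  rw [card_filter_le_eq_rightInversions_add hf hle hp, left_eq_add, card_eq_zero,
    filter_eq_empty_iff]
  constructor
  · intro hfp
    refine ⟨by simpa only [hfp, mem_coe] using hf.mapsTo hp, fun q _ h => ?_⟩
    exact (h.2.1.trans_le h.2.2).ne hfp
  · rintro ⟨hpV, hempty⟩
    obtain ⟨q, hq, hqp⟩ := hf.surjOn hpV
    rcases (hqp ▸ hle q hq : p ≤ q).eq_or_lt with rfl | hpq
    · exact hqp
    · have hne : f p ≠ f q := fun h => hpq.ne (hf.injOn hp hq h)
      exact absurd ⟨hpq, lt_of_le_of_ne (hqp ▸ hle p hp) hne, hqp.le⟩ (hempty hq)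

theorem apply_eq_self_iff_leftInversions (hf : Set.BijOn f P V) (hle : ∀ q ∈ P, q ≤ f q)
    (hp : p ∈ P) :
    f p = p ↔ p ∈ V ∧ leftInversions P f p + #{q ∈ P | p < q} + 1 = #{v ∈ V | p ≤ v} :=
  apply_eq_self_iff_rightInversions (α := αᵒᵈ) hf hle hp

end InversionCode

/-! ### Words of labelled rises and falls -/

section Word

/-- The height increment of a rise (`true`) or of a fall (`false`). -/
def slope (b : Bool) : ℤ := if b then 1 else -1

/-- The labels `x` of a rise (`true`) or a fall (`false`) that starts at height `h ≥ 0` are those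
with `2 * x ≤ labelBound h b`: this clears the ceilings from `x ≤ ⌈h/2⌉` and `x ≤ ⌈(h-1)/2⌉`. For
`h = -1` it allows the label `0` of a rise and no label of a fall, which keeps the almost-Dyck path
at heights `≥ -1`. -/
def labelBound (h : ℤ) (b : Bool) : ℤ := h + if b then 1 else 0

variable {N : ℕ}

/-- The height at abscissa `k` of the path encoded by `w`, whose step from abscissa `j` is a rise if
`(w j).1` and a fall otherwise; `(w j).2` is the label of this step. -/
def wordHeight (w : Fin N → Bool × ℕ) (k : ℕ) : ℤ :=
  ∑ j ∈ univ.filter (fun j : Fin N => (j : ℕ) < k), slope (w j).1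

/-- The words of labelled almost-Dyck paths that encode D-permutations. -/
def IsDWord (w : Fin N → Bool × ℕ) : Prop :=
  wordHeight w N = 0 ∧ ∀ k : Fin N, 2 * ((w k).2 : ℤ) ≤ labelBound (wordHeight w k) (w k).1

/-- The positions of the rises of a word. -/
def riseSet (w : Fin N → Bool × ℕ) : Finset (Fin N) := {k | (w k).1 = true}

/-- The positions of the falls of a word. -/
def fallSet (w : Fin N → Bool × ℕ) : Finset (Fin N) := {k | (w k).1 = false}

/-- The even letters of `[N]`, the letter `j + 1` being represented by `j : Fin N`. -/
def evenLetters (N : ℕ) : Finset (Fin N) := {j | Even ((j : ℕ) + 1)}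

/-- The odd letters of `[N]`, the letter `j + 1` being represented by `j : Fin N`. -/
def oddLetters (N : ℕ) : Finset (Fin N) := {j | Odd ((j : ℕ) + 1)}

theorem mem_evenLetters {j : Fin N} : j ∈ evenLetters N ↔ Even ((j : ℕ) + 1) := by
  simp [evenLetters]

theorem mem_oddLetters {j : Fin N} : j ∈ oddLetters N ↔ Odd ((j : ℕ) + 1) := by
  simp [oddLetters]

theorem mem_riseSet {w : Fin N → Bool × ℕ} {k : Fin N} : k ∈ riseSet w ↔ (w k).1 = true := by
  simp [riseSet]

theorem mem_fallSet {w : Fin N → Bool × ℕ} {k : Fin N} : k ∈ fallSet w ↔ (w k).1 = false := by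
  simp [fallSet]

theorem compl_evenLetters : (evenLetters N)ᶜ = oddLetters N := by
  ext j
  rw [mem_compl, mem_evenLetters, mem_oddLetters, Nat.not_even_iff_odd]

theorem mem_evenLetters_or_mem_oddLetters (j : Fin N) : j ∈ evenLetters N ∨ j ∈ oddLetters N := by
  rw [← compl_evenLetters, mem_compl]
  exact em _

theorem compl_riseSet (w : Fin N → Bool × ℕ) : (riseSet w)ᶜ = fallSet w := by
  ext k
  rw [mem_compl, mem_riseSet, mem_fallSet, Bool.not_eq_true]

theorem wordHeight_zero (w : Fin N → Bool × ℕ) : wordHeight w 0 = 0 := by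
  simp [wordHeight]

theorem wordHeight_add_one (w : Fin N → Bool × ℕ) (k : Fin N) :
    wordHeight w (k + 1) = wordHeight w k + slope (w k).1 := by
  have hfilter : univ.filter (fun j : Fin N => (j : ℕ) < k + 1) =
      insert k (univ.filter fun j : Fin N => (j : ℕ) < k) := by
    ext j
    simp only [mem_filter, mem_univ, true_and, mem_insert, Fin.ext_iff]
    lia
  rw [wordHeight, hfilter, sum_insert (by simp), wordHeight, add_comm]

theorem card_filter_val_lt_add_one (s : Finset (Fin N)) {k : ℕ} (hk : k < N) :
    #{j ∈ s | j.val < k + 1} = #{j ∈ s | j.val < k} + if ⟨k, hk⟩ ∈ s then 1 else 0 := by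
  rw [← sum_ite_eq s ⟨k, hk⟩ fun _ => 1, card_filter, card_filter, ← sum_add_distrib]
  refine sum_congr rfl fun j _ => ?_
  simp only [Fin.ext_iff]
  split_ifs <;> lia

theorem card_evenLetters_filter_lt {k : ℕ} (hk : k ≤ N) :
    #{j ∈ evenLetters N | j.val < k} = k / 2 := by
  induction k with
  | zero => simp
  | succ k ih =>
    rw [card_filter_val_lt_add_one _ hk, ih (by lia)]
    simp only [mem_evenLetters, Nat.even_iff]
    lia

theorem wordHeight_eq (w : Fin N → Bool × ℕ) {k : ℕ} (hk : k ≤ N) :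
    wordHeight w k = 2 * (#{j ∈ riseSet w | j.val < k} : ℤ) - k := by
  induction k with
  | zero => simp [wordHeight_zero]
  | succ k ih =>
    rw [wordHeight_add_one w ⟨k, hk⟩, card_filter_val_lt_add_one _ hk, ih (by lia), slope]
    simp only [mem_riseSet]
    split_ifs <;> push_cast <;> ring

theorem card_compl_filter_le_add (s : Finset (Fin N)) {k : ℕ} (hk : k ≤ N) :
    #{j ∈ sᶜ | k ≤ j.val} + k + #s = N + #{j ∈ s | j.val < k} := by
  have hlt : #(univ.filter fun j : Fin N => j.val < k) = k := by
    rw [Fin.card_filter_val_lt, min_eq_right hk]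
  have hN : #(univ.filter fun j : Fin N => j.val < k) +
      #(univ.filter fun j : Fin N => k ≤ j.val) = N := by
    simpa using card_filter_add_card_filter_not (s := univ) fun j : Fin N => j.val < k
  have hs := card_filter_add_card_filter_not (s := s) fun j => j.val < k
  have hge : #{j ∈ s | k ≤ j.val} + #{j ∈ sᶜ | k ≤ j.val} =
      #(univ.filter fun j : Fin N => k ≤ j.val) := by
    rw [← card_union_of_disjoint (disjoint_filter_filter disjoint_compl_right), ← filter_union,
      union_compl]
  simp only [not_lt] at hs
  lia

variable {n : ℕ} {w : Fin (2 * n) → Bool × ℕ} {k : Fin (2 * n)}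

theorem card_evenLetters : #(evenLetters (2 * n)) = n := by
  simpa using card_evenLetters_filter_lt (N := 2 * n) le_rfl

theorem card_riseSet (hw : wordHeight w (2 * n) = 0) : #(riseSet w) = n := by
  have h := wordHeight_eq w le_rfl
  rw [hw, filter_true_of_mem fun j _ => j.isLt] at h
  lia

theorem two_mul_card_riseSet_filter_le (w : Fin N → Bool × ℕ) {k : Fin N}
    (hk : k ∈ evenLetters N) :
    2 * (#{v ∈ riseSet w | v ≤ k} : ℤ) =
      2 * #{q ∈ evenLetters N | q < k} + wordHeight w k + slope (w k).1 + 2 := by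
  have hE := card_evenLetters_filter_lt (N := N) k.isLt.le
  have hR := wordHeight_eq w k.isLt
  simp only [Nat.lt_succ_iff, Fin.val_fin_le, Fin.val_fin_lt] at hE hR
  rw [Nat.succ_eq_add_one, wordHeight_add_one] at hR
  rw [mem_evenLetters, Nat.even_iff] at hk
  lia

theorem two_mul_card_fallSet_filter_ge (hw : wordHeight w (2 * n) = 0)
    (hk : k ∈ oddLetters (2 * n)) :
    2 * (#{v ∈ fallSet w | k ≤ v} : ℤ) =
      2 * #{q ∈ oddLetters (2 * n) | k < q} + wordHeight w k + 2 := by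
  have hE := card_evenLetters_filter_lt (N := 2 * n) k.isLt
  have hO := card_compl_filter_le_add (evenLetters (2 * n)) k.isLt
  have hR := wordHeight_eq w k.isLt.le
  have hF := card_compl_filter_le_add (riseSet w) k.isLt.le
  rw [compl_evenLetters, card_evenLetters] at hO
  rw [compl_riseSet, card_riseSet hw] at hF
  simp only [Nat.succ_le_iff, Fin.val_fin_le, Fin.val_fin_lt] at hO hF hR
  rw [mem_oddLetters, Nat.odd_iff] at hk
  lia

theorem add_card_lt_card_riseSet_iff (w : Fin N → Bool × ℕ) {k : Fin N} (hk : k ∈ evenLetters N)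
    (c : ℕ) :
    c + #{q ∈ evenLetters N | q < k} < #{v ∈ riseSet w | v ≤ k} ↔
      2 * (c : ℤ) ≤ labelBound (wordHeight w k) (w k).1 := by
  have hcard := two_mul_card_riseSet_filter_le w hk
  have hheight := wordHeight_eq w k.isLt.le
  rw [mem_evenLetters, Nat.even_iff] at hk
  unfold slope at hcard
  unfold labelBound
  split_ifs at * <;> lia

theorem add_card_lt_card_fallSet_iff (hw : wordHeight w (2 * n) = 0)
    (hk : k ∈ oddLetters (2 * n)) (c : ℕ) :
    c + #{q ∈ oddLetters (2 * n) | k < q} < #{v ∈ fallSet w | k ≤ v} ↔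
      2 * (c : ℤ) ≤ labelBound (wordHeight w k) (w k).1 := by
  have hcard := two_mul_card_fallSet_filter_ge hw hk
  have hheight := wordHeight_eq w k.isLt.le
  rw [mem_oddLetters, Nat.odd_iff] at hk
  unfold labelBound
  split_ifs at * <;> lia

theorem mem_riseSet_and_add_card_eq_iff (w : Fin N → Bool × ℕ) {k : Fin N}
    (hk : k ∈ evenLetters N) (c : ℕ) :
    (k ∈ riseSet w ∧
        c + #{q ∈ evenLetters N | q < k} + 1 = #{v ∈ riseSet w | v ≤ k}) ↔
      2 * (c : ℤ) = labelBound (wordHeight w k) (w k).1 := by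
  have hcard := two_mul_card_riseSet_filter_le w hk
  have hheight := wordHeight_eq w k.isLt.le
  rw [mem_evenLetters, Nat.even_iff] at hk
  rw [mem_riseSet]
  unfold slope at hcard
  unfold labelBound
  split_ifs at * <;> lia

theorem mem_fallSet_and_add_card_eq_iff (hw : wordHeight w (2 * n) = 0)
    (hk : k ∈ oddLetters (2 * n)) (c : ℕ) :
    (k ∈ fallSet w ∧
        c + #{q ∈ oddLetters (2 * n) | k < q} + 1 = #{v ∈ fallSet w | k ≤ v}) ↔
      2 * (c : ℤ) = labelBound (wordHeight w k) (w k).1 := by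
  have hcard := two_mul_card_fallSet_filter_ge hw hk
  have hheight := wordHeight_eq w k.isLt.le
  rw [mem_oddLetters, Nat.odd_iff] at hk
  rw [mem_fallSet]
  unfold labelBound
  split_ifs at * with h <;> simp only [h, Bool.not_eq_true] at * <;> lia

end Word

/-! ### The word of a D-permutation -/

section PermWord

theorem exists_perm_of_bijOn {α : Type*} {P R : Set α} {f g : α → α} (hf : Set.BijOn f P R)
    (hg : Set.BijOn g Pᶜ Rᶜ) : ∃ σ : Equiv.Perm α, Set.EqOn σ f P ∧ Set.EqOn σ g Pᶜ := by
  classical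
  have hf' : Set.BijOn (P.piecewise f g) P R :=
    (Set.piecewise_eqOn P f g).bijOn_iff.2 hf
  have hg' : Set.BijOn (P.piecewise f g) Pᶜ Rᶜ :=
    (Set.piecewise_eqOn_compl P f g).bijOn_iff.2 hg
  have hne : ∀ a ∈ P, ∀ b ∈ Pᶜ, P.piecewise f g a ≠ P.piecewise f g b := fun a ha b hb h =>
    hg'.mapsTo hb (h ▸ hf'.mapsTo ha)
  have hbij := hf'.union hg' <|
    (Set.injOn_union disjoint_compl_right).2 ⟨hf'.injOn, hg'.injOn, hne⟩
  rw [Set.union_compl_self, Set.union_compl_self, Set.bijOn_univ] at hbij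
  exact ⟨Equiv.ofBijective _ hbij, Set.piecewise_eqOn P f g, Set.piecewise_eqOn_compl P f g⟩

variable {n : ℕ}

/-- The almost-Dyck path of `σ`, each step labelled by the number of nestings of its letter. -/
def word (σ : Equiv.Perm (Fin (2 * n))) (k : Fin (2 * n)) : Bool × ℕ :=
  (decide (Even ((σ.symm k : ℕ) + 1)), nestLabel σ k)

variable {σ τ : Equiv.Perm (Fin (2 * n))} {k : Fin (2 * n)}

theorem wordHeight_word (σ : Equiv.Perm (Fin (2 * n))) (k : ℕ) :
    wordHeight (word σ) k = almostDyckHeight σ k := by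
  simp [wordHeight, almostDyckHeight, slope, word]

theorem mem_riseSet_word : k ∈ riseSet (word σ) ↔ σ.symm k ∈ evenLetters (2 * n) := by
  simp [mem_riseSet, mem_evenLetters, word]

theorem mem_fallSet_word : k ∈ fallSet (word σ) ↔ σ.symm k ∈ oddLetters (2 * n) := by
  simp [mem_fallSet, mem_oddLetters, word]

theorem bijOn_evenLetters (σ : Equiv.Perm (Fin (2 * n))) :
    Set.BijOn σ (evenLetters (2 * n)) (riseSet (word σ)) :=
  σ.bijOn fun k => by simp [mem_riseSet_word]

theorem bijOn_oddLetters (σ : Equiv.Perm (Fin (2 * n))) :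
    Set.BijOn σ (oddLetters (2 * n)) (fallSet (word σ)) :=
  σ.bijOn fun k => by simp [mem_fallSet_word]

theorem wordHeight_word_two_mul (σ : Equiv.Perm (Fin (2 * n))) :
    wordHeight (word σ) (2 * n) = 0 := by
  rw [wordHeight_eq _ le_rfl, filter_true_of_mem fun j _ => j.isLt]
  have := (bijOn_evenLetters σ).finsetCard_eq
  rw [card_evenLetters] at this
  rw [← this]
  push_cast
  ring

theorem isDPerm_iff : IsDPerm σ ↔
    (∀ q ∈ evenLetters (2 * n), σ q ≤ q) ∧ ∀ q ∈ oddLetters (2 * n), q ≤ σ q := by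
  simp only [mem_evenLetters, mem_oddLetters, ← forall_and, IsDPerm, and_comm]

theorem IsDPerm.mem_evenLetters_of_apply_lt (hσ : IsDPerm σ) {i : Fin (2 * n)} (h : σ i < i) :
    i ∈ evenLetters (2 * n) := by
  rw [mem_evenLetters, ← Nat.not_odd_iff_even]
  exact fun hodd => h.not_ge ((hσ i).1 hodd)

theorem IsDPerm.mem_oddLetters_of_lt_apply (hσ : IsDPerm σ) {i : Fin (2 * n)} (h : i < σ i) :
    i ∈ oddLetters (2 * n) := by
  rw [mem_oddLetters, ← Nat.not_even_iff_odd]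
  exact fun heven => h.not_ge ((hσ i).2 heven)

theorem nestLabel_eq_rightInversions (hσ : IsDPerm σ) (hk : k ∈ evenLetters (2 * n)) :
    nestLabel σ k = rightInversions (evenLetters (2 * n)) σ k := by
  rw [nestLabel, if_pos (mem_evenLetters.1 hk), rightInversions]
  congr 1
  ext j
  simp only [mem_filter, mem_univ, true_and]
  have hkk := (isDPerm_iff.1 hσ).1 k hk
  constructor
  · rintro ⟨hjk, -, hkj⟩
    exact ⟨hσ.mem_evenLetters_of_apply_lt (hjk.trans_le (hkk.trans hkj.le)), hkj, hjk⟩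
  · rintro ⟨-, hkj, hjk⟩
    exact ⟨hjk, hkk, hkj⟩

theorem nestLabel_eq_leftInversions (hσ : IsDPerm σ) (hk : k ∈ oddLetters (2 * n)) :
    nestLabel σ k = leftInversions (oddLetters (2 * n)) σ k := by
  rw [nestLabel, if_neg (Nat.not_even_iff_odd.2 (mem_oddLetters.1 hk)), leftInversions]
  congr 1
  ext j
  simp only [mem_filter, mem_univ, true_and]
  have hkk := (isDPerm_iff.1 hσ).2 k hk
  constructor
  · rintro ⟨hjk, -, hkj⟩
    exact ⟨hσ.mem_oddLetters_of_lt_apply (hjk.trans (hkk.trans_lt hkj)), hjk, hkj⟩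
  · rintro ⟨-, hjk, hkj⟩
    exact ⟨hjk, hkk, hkj⟩

theorem isDWord_word (hσ : IsDPerm σ) : IsDWord (word σ) := by
  obtain ⟨heven, hodd⟩ := isDPerm_iff.1 hσ
  refine ⟨wordHeight_word_two_mul σ, fun k => ?_⟩
  change 2 * (nestLabel σ k : ℤ) ≤ _
  rcases mem_evenLetters_or_mem_oddLetters k with hk | hk
  · rw [nestLabel_eq_rightInversions hσ hk, ← add_card_lt_card_riseSet_iff _ hk]
    exact rightInversions_add_card_lt (bijOn_evenLetters σ) heven hk
  · rw [nestLabel_eq_leftInversions hσ hk,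
      ← add_card_lt_card_fallSet_iff (wordHeight_word_two_mul σ) hk]
    exact leftInversions_add_card_lt (bijOn_oddLetters σ) hodd hk

theorem apply_eq_self_iff_two_mul_nestLabel_eq (hσ : IsDPerm σ) (k : Fin (2 * n)) :
    σ k = k ↔ 2 * (nestLabel σ k : ℤ) = labelBound (wordHeight (word σ) k) (word σ k).1 := by
  obtain ⟨heven, hodd⟩ := isDPerm_iff.1 hσ
  rcases mem_evenLetters_or_mem_oddLetters k with hk | hk
  · rw [nestLabel_eq_rightInversions hσ hk, ← mem_riseSet_and_add_card_eq_iff _ hk]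
    exact apply_eq_self_iff_rightInversions (bijOn_evenLetters σ) heven hk
  · rw [nestLabel_eq_leftInversions hσ hk,
      ← mem_fallSet_and_add_card_eq_iff (wordHeight_word_two_mul σ) hk]
    exact apply_eq_self_iff_leftInversions (bijOn_oddLetters σ) hodd hk

theorem injOn_word : Set.InjOn (word (n := n)) (DPerms n) := by
  intro σ hσ τ hτ h
  have hlabel (k : Fin (2 * n)) : nestLabel σ k = nestLabel τ k := congr_arg (fun w => (w k).2) h
  have heven : Set.EqOn σ τ (evenLetters (2 * n)) :=
    eqOn_of_rightInversions_eq (bijOn_evenLetters σ) (h ▸ bijOn_evenLetters τ) fun k hk => by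
      rw [← nestLabel_eq_rightInversions hσ hk, ← nestLabel_eq_rightInversions hτ hk, hlabel]
  have hodd : Set.EqOn σ τ (oddLetters (2 * n)) :=
    eqOn_of_leftInversions_eq (bijOn_oddLetters σ) (h ▸ bijOn_oddLetters τ) fun k hk => by
      rw [← nestLabel_eq_leftInversions hσ hk, ← nestLabel_eq_leftInversions hτ hk, hlabel]
  ext1 k
  exact (mem_evenLetters_or_mem_oddLetters k).elim (fun hk => heven hk) fun hk => hodd hk

theorem surjOn_word : Set.SurjOn (word (n := n)) (DPerms n) {w | IsDWord w} := by
  rintro w ⟨hw, hbound⟩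
  have hR : #(riseSet w) = n := card_riseSet hw
  obtain ⟨f, hf, hfc⟩ := exists_bijOn_rightInversions_eq (evenLetters (2 * n)) (riseSet w)
    (fun k => (w k).2) (by rw [card_evenLetters, hR])
    fun k hk => (add_card_lt_card_riseSet_iff w hk _).2 (hbound k)
  obtain ⟨g, hg, hgc⟩ := exists_bijOn_leftInversions_eq (oddLetters (2 * n)) (fallSet w)
    (fun k => (w k).2)
    (by rw [← compl_evenLetters, ← compl_riseSet, card_compl, card_compl, card_evenLetters, hR])
    fun k hk => (add_card_lt_card_fallSet_iff hw hk _).2 (hbound k)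
  obtain ⟨σ, hσf, hσg⟩ := exists_perm_of_bijOn hf (g := g)
    (by rwa [← coe_compl, ← coe_compl, compl_evenLetters, compl_riseSet])
  rw [← coe_compl, compl_evenLetters] at hσg
  have hσ : IsDPerm σ := isDPerm_iff.2
    ⟨fun k hk => hσf hk ▸ (hfc k hk).1, fun k hk => hσg hk ▸ (hgc k hk).1⟩
  refine ⟨σ, hσ, funext fun k => Prod.ext ?_ ?_⟩
  · have hrise : riseSet (word σ) = riseSet w := by
      have := (bijOn_evenLetters σ).image_eq
      rw [hσf.image_eq, hf.image_eq] at this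
      exact_mod_cast this.symm
    rw [Bool.eq_iff_iff, ← mem_riseSet, ← mem_riseSet, hrise]
  · change nestLabel σ k = (w k).2
    rcases mem_evenLetters_or_mem_oddLetters k with hk | hk
    · rw [nestLabel_eq_rightInversions hσ hk, rightInversions_congr hσf hk, (hfc k hk).2]
    · rw [nestLabel_eq_leftInversions hσ hk, leftInversions_congr hσg hk, (hgc k hk).2]

theorem bijOn_word : Set.BijOn (word (n := n)) (DPerms n) {w | IsDWord w} :=
  ⟨fun _ => isDWord_word, injOn_word, surjOn_word⟩

end PermWord

/-! ### From almost-Dyck words to labelled Schröder paths -/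

section Contraction

variable {h : ℕ} {s : Step × ℕ} {p : LabelledSteps}

/-- The labelled 0-Schröder paths of the Deb–Sokal bijection that start at height `h`. -/
abbrev IsDSFrom (h : ℕ) (p : LabelledSteps) : Prop := IsLabelledFrom labelA labelB labelC h p

/-- The labelled steps from height `h` in these paths, with the ceilings cleared from the bounds on
the labels. -/
def IsLabelledStep (h : ℕ) : Step × ℕ → Prop
  | (.rise, x) => 2 * x ≤ h + 1
  | (.fall, x) => 1 ≤ h ∧ 2 * x ≤ h
  | (.level, x) => h = 0 ∧ x = 0

theorem mem_labelA {x : ℕ} : x ∈ labelA h ↔ 2 * x ≤ h + 1 := by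
  rw [labelA, Set.mem_ofPred_eq, Nat.ceilDiv_eq_add_pred_div]
  lia

theorem mem_labelB {x : ℕ} (hh : 1 ≤ h) : x ∈ labelB h ↔ 2 * x ≤ h := by
  rw [labelB, Set.mem_ofPred_eq, Nat.ceilDiv_eq_add_pred_div]
  lia

theorem isDSFrom_cons : IsDSFrom h (s :: p) ↔ IsLabelledStep h s ∧ IsDSFrom (s.1.next h) p := by
  obtain ⟨_ | _ | _, x⟩ := s
  · simp [IsDSFrom, IsLabelledFrom, IsLabelledStep, Step.next, mem_labelA]
  · simp only [IsDSFrom, IsLabelledFrom, IsLabelledStep, Step.next, and_assoc]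
    exact and_congr_right fun hh => by rw [mem_labelB hh]
  · simp [IsDSFrom, IsLabelledFrom, IsLabelledStep, Step.next, labelC]

/-- `IsDWord` for words in list form, starting at height `h`. -/
def IsDWordFrom : ℤ → List (Bool × ℕ) → Prop
  | h, [] => h = 0
  | h, s :: l => 2 * (s.2 : ℤ) ≤ labelBound h s.1 ∧ IsDWordFrom (h + slope s.1) l

theorem wordHeight_succ {N : ℕ} (w : Fin (N + 1) → Bool × ℕ) (k : ℕ) :
    wordHeight w (k + 1) = slope (w 0).1 + wordHeight (fun j => w j.succ) k := by
  simp [wordHeight, sum_filter, Fin.sum_univ_succ]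

theorem isDWordFrom_ofFn {N : ℕ} (h : ℤ) (w : Fin N → Bool × ℕ) :
    IsDWordFrom h (List.ofFn w) ↔ h + wordHeight w N = 0 ∧
      ∀ k : Fin N, 2 * ((w k).2 : ℤ) ≤ labelBound (h + wordHeight w k) (w k).1 := by
  induction N generalizing h with
  | zero => simp [IsDWordFrom, wordHeight_zero]
  | succ N ih =>
    simp only [List.ofFn_succ, IsDWordFrom, ih, Fin.forall_fin_succ, Fin.val_zero, Fin.val_succ,
      wordHeight_zero, wordHeight_succ, add_zero, add_assoc]
    tauto

theorem bijOn_ofFn (N : ℕ) : Set.BijOn List.ofFn {w : Fin N → Bool × ℕ | IsDWord w}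
    {l | l.length = N ∧ IsDWordFrom 0 l} := by
  have hiff (w : Fin N → Bool × ℕ) : IsDWordFrom 0 (List.ofFn w) ↔ IsDWord w := by
    simp [isDWordFrom_ofFn, IsDWord]
  refine ⟨fun w hw => ⟨List.length_ofFn, (hiff w).2 hw⟩, List.ofFn_injective.injOn, ?_⟩
  rintro l ⟨rfl, hl⟩
  exact ⟨l.get, (hiff _).1 (by rwa [List.ofFn_get]), List.ofFn_get l⟩

/-- Replaces each long level step by a fall and a rise, both with label `0`. -/
def expand : LabelledSteps → List (Bool × ℕ)
  | [] => []
  | (.rise, x) :: p => (true, x) :: expand p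
  | (.fall, x) :: p => (false, x) :: expand p
  | (.level, _) :: p => (false, 0) :: (true, 0) :: expand p

theorem length_expand (p : LabelledSteps) : (expand p).length = pathLength p := by
  induction p with
  | nil => rfl
  | cons s p ih =>
    obtain ⟨_ | _ | _, x⟩ := s <;>
      simp only [expand, List.length_cons, ih, pathLength, List.map_cons, List.sum_cons,
        Step.width] <;> ring

theorem isDWordFrom_expand (hp : IsDSFrom h p) : IsDWordFrom h (expand p) := by
  induction p generalizing h with
  | nil => simpa [expand, IsDWordFrom, IsLabelledFrom] using hp
  | cons s p ih =>
    obtain ⟨hs, hp⟩ := isDSFrom_cons.1 hp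
    specialize ih hp
    obtain ⟨_ | _ | _, x⟩ := s
    · refine ⟨?_, by simpa [slope, Step.next] using ih⟩
      simp only [IsLabelledStep, labelBound, if_true] at hs ⊢
      lia
    · refine ⟨?_, ?_⟩
      · simp only [IsLabelledStep, labelBound] at hs ⊢
        lia
      · simpa [slope, Step.next, Nat.cast_sub hs.1, sub_eq_add_neg] using ih
    · obtain ⟨rfl, rfl⟩ := hs
      exact ⟨le_rfl, le_rfl, ih⟩

theorem exists_expand_eq : ∀ {h : ℕ} {l : List (Bool × ℕ)}, IsDWordFrom h l →
    ∃ p, IsDSFrom h p ∧ expand p = l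
  | h, [], hl => ⟨[], by simpa [IsDWordFrom, IsLabelledFrom] using hl, rfl⟩
  | h, (true, x) :: l, ⟨hx, hl⟩ => by
    obtain ⟨p, hp, rfl⟩ := exists_expand_eq (h := h + 1) (by simpa [slope] using hl)
    refine ⟨(.rise, x) :: p, isDSFrom_cons.2 ⟨?_, hp⟩, rfl⟩
    simp only [labelBound, if_true] at hx
    simp only [IsLabelledStep]
    lia
  | h + 1, (false, x) :: l, ⟨hx, hl⟩ => by
    obtain ⟨p, hp, rfl⟩ := exists_expand_eq (h := h) (by simpa [slope] using hl)
    refine ⟨(.fall, x) :: p, isDSFrom_cons.2 ⟨⟨by lia, ?_⟩, hp⟩, rfl⟩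
    simp only [labelBound, Bool.false_eq_true, if_false] at hx
    lia
  | 0, [(false, x)], ⟨_, hl⟩ => by simp [IsDWordFrom, slope] at hl
  | 0, (false, x) :: (b, y) :: l, ⟨hx, hy, hl⟩ => by
    obtain ⟨rfl, rfl, rfl⟩ : x = 0 ∧ b = true ∧ y = 0 := by
      cases b <;>
        simp only [labelBound, slope, Bool.false_eq_true, if_false, if_true, true_and]
          at hx hy ⊢ <;>
        lia
    obtain ⟨p, hp, rfl⟩ := exists_expand_eq (h := 0) (by simpa [slope] using hl)
    exact ⟨(.level, 0) :: p, isDSFrom_cons.2 ⟨⟨rfl, rfl⟩, hp⟩, rfl⟩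

/-- What becomes of a letter at height `h` when each fall from height `0` and the rise from height
`-1` after it are replaced by a long level step. -/
def contractLetter (h : ℤ) (s : Bool × ℕ) : Option (Step × ℕ) :=
  if h < 0 then none
  else if s.1 then some (.rise, s.2)
  else if h = 0 then some (.level, 0)
  else some (.fall, s.2)

/-- The left inverse of `expand` on paths that start at height `h`. -/
def contract : ℤ → List (Bool × ℕ) → LabelledSteps
  | _, [] => []
  | h, s :: l => (contractLetter h s).toList ++ contract (h + slope s.1) l

theorem contract_expand (hp : IsDSFrom h p) : contract h (expand p) = p := by
  induction p generalizing h with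
  | nil => rfl
  | cons s p ih =>
    obtain ⟨hs, hp⟩ := isDSFrom_cons.1 hp
    specialize ih hp
    obtain ⟨_ | _ | _, x⟩ := s
    · have hnonneg : ¬ (h : ℤ) < 0 := by lia
      simpa [expand, contract, contractLetter, slope, Step.next, hnonneg] using ih
    · obtain ⟨h, rfl⟩ := Nat.exists_eq_add_of_le' hs.1
      have hne : ¬ (h : ℤ) + 1 < 0 ∧ (h : ℤ) + 1 ≠ 0 := by lia
      simpa [expand, contract, contractLetter, slope, Step.next, hne] using ih
    · obtain ⟨rfl, rfl⟩ := hs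
      simpa [expand, contract, contractLetter, slope, Step.next] using ih

theorem bijOn_expand (n : ℕ) :
    Set.BijOn expand (DSPaths n) {l | l.length = 2 * n ∧ IsDWordFrom 0 l} := by
  refine ⟨fun p hp => ⟨(length_expand p).trans hp.1, isDWordFrom_expand hp.2⟩,
    Set.LeftInvOn.injOn (f₁' := contract 0) fun p hp => contract_expand hp.2, ?_⟩
  rintro l ⟨hlength, hl⟩
  obtain ⟨p, hp, rfl⟩ := exists_expand_eq (h := 0) hl
  exact ⟨p, ⟨(length_expand p).symm.trans hlength, hp⟩, rfl⟩

theorem bijOn_contract (n : ℕ) :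
    Set.BijOn (contract 0) {l | l.length = 2 * n ∧ IsDWordFrom 0 l} (DSPaths n) := by
  have hinv : Set.LeftInvOn (contract 0) expand (DSPaths n) := fun p hp => contract_expand hp.2
  have hexpand := bijOn_expand n
  exact hexpand.symm ⟨hexpand.image_eq ▸ hinv.rightInvOn_image, hinv⟩

theorem filterMap_contractLetter {N : ℕ} (h : ℤ) (w : Fin N → Bool × ℕ) :
    (List.finRange N).filterMap (fun k : Fin N => contractLetter (h + wordHeight w k) (w k)) =
      contract h (List.ofFn w) := by
  induction N generalizing h with
  | zero => simp [contract]
  | succ N ih =>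
    rw [List.ofFn_succ, contract, ← ih, List.finRange_succ, ← List.singleton_append,
      List.filterMap_append, List.filterMap_map]
    congr 1
    · cases hletter : contractLetter h (w 0) <;> simp [wordHeight_zero, hletter]
    · simp only [Function.comp_def, Fin.val_succ, wordHeight_succ, add_assoc]

variable {n : ℕ}

theorem dsStep_eq_contractLetter (σ : Equiv.Perm (Fin (2 * n))) (k : Fin (2 * n)) :
    dsStep σ k = contractLetter (wordHeight (word σ) k) (word σ k) := by
  simp [dsStep, contractLetter, wordHeight_word, word]

theorem dsMap_eq_contract (σ : Equiv.Perm (Fin (2 * n))) :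
    dsMap σ = contract 0 (List.ofFn (word σ)) := by
  rw [dsMap, ← filterMap_contractLetter]
  simp only [zero_add, ← dsStep_eq_contractLetter]

theorem bijOn_dsMap (n : ℕ) : Set.BijOn (dsMap (n := n)) (DPerms n) (DSPaths n) :=
  ((bijOn_contract n).comp ((bijOn_ofFn (2 * n)).comp bijOn_word)).congr fun σ _ =>
    (dsMap_eq_contract σ).symm

end Contraction

/-! ### The label complement and the Genocchi–Corteel involution -/

section Complement

variable {i h x : ℕ} {s : Step} {p : LabelledSteps}

theorem isLabelledStep_compLabel (hs : IsLabelledStep h (s, x)) :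
    IsLabelledStep h (s, compLabel i h x s) := by
  cases s <;> simp only [IsLabelledStep, compLabel, Nat.ceilDiv_eq_add_pred_div] at hs ⊢ <;>
    lia

theorem compLabel_compLabel (hs : IsLabelledStep h (s, x)) :
    compLabel i h (compLabel i h x s) s = x := by
  cases s <;> simp only [IsLabelledStep, compLabel, Nat.ceilDiv_eq_add_pred_div] at hs ⊢ <;>
    lia

theorem compLabel_eq_self_iff (hi : Odd (i + h)) (hh : h ≤ 2) (hs : IsLabelledStep h (s, x)) :
    compLabel i h x s = x ↔ s.next h ≤ 2 := by
  rw [Nat.odd_iff] at hi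
  cases s <;>
    simp only [IsLabelledStep, compLabel, Step.next, Nat.ceilDiv_eq_add_pred_div, Nat.even_iff]
      at hs ⊢ <;>
    interval_cases h <;> lia

theorem odd_add_width_add_next (hi : Odd (i + h)) (hs : IsLabelledStep h (s, x)) :
    Odd (i + s.width + s.next h) := by
  rw [Nat.odd_iff] at hi ⊢
  cases s <;> simp only [IsLabelledStep, Step.width, Step.next] at hs ⊢ <;> lia

theorem pathLength_complementFrom (i h : ℕ) (p : LabelledSteps) :
    pathLength (complementFrom i h p) = pathLength p := by
  induction p generalizing i h with
  | nil => rfl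
  | cons s p ih =>
    simpa only [complementFrom, pathLength, List.map_cons, List.sum_cons, add_right_inj]
      using ih (i + s.1.width) (s.1.next h)

theorem isDSFrom_complementFrom (i : ℕ) (hp : IsDSFrom h p) :
    IsDSFrom h (complementFrom i h p) := by
  induction p generalizing i h with
  | nil => exact hp
  | cons s p ih =>
    obtain ⟨hs, hp⟩ := isDSFrom_cons.1 hp
    exact isDSFrom_cons.2 ⟨isLabelledStep_compLabel hs, ih _ hp⟩

theorem complementFrom_complementFrom (i : ℕ) (hp : IsDSFrom h p) :
    complementFrom i h (complementFrom i h p) = p := by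
  induction p generalizing i h with
  | nil => rfl
  | cons s p ih =>
    obtain ⟨hs, hp⟩ := isDSFrom_cons.1 hp
    rw [complementFrom, complementFrom, compLabel_compLabel hs, ih _ hp]

theorem le_maxHeightFrom (h : ℕ) (p : LabelledSteps) : h ≤ maxHeightFrom h p := by
  cases p <;> simp [maxHeightFrom]

theorem complementFrom_eq_self_iff (hi : Odd (i + h)) (hh : h ≤ 2) (hp : IsDSFrom h p) :
    complementFrom i h p = p ↔ maxHeightFrom h p ≤ 2 := by
  induction p generalizing i h with
  | nil => simpa [complementFrom, maxHeightFrom] using hh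
  | cons s p ih =>
    obtain ⟨hs, hp⟩ := isDSFrom_cons.1 hp
    have hlabel := compLabel_eq_self_iff hi hh hs
    have htail (hnext : s.1.next h ≤ 2) := ih (odd_add_width_add_next hi hs) hnext hp
    have hle := le_maxHeightFrom (s.1.next h) p
    simp only [complementFrom, maxHeightFrom, List.cons.injEq, Prod.ext_iff, true_and,
      max_le_iff, hh, hlabel]
    exact ⟨fun hfix => (htail hfix.1).1 hfix.2, fun hmax =>
      ⟨hle.trans hmax, (htail (hle.trans hmax)).2 hmax⟩⟩

variable {n : ℕ}

theorem complement_mem_DSPaths (hp : p ∈ DSPaths n) : complement p ∈ DSPaths n :=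
  ⟨(pathLength_complementFrom 1 0 p).trans hp.1, isDSFrom_complementFrom 1 hp.2⟩

theorem complement_complement (hp : p ∈ DSPaths n) : complement (complement p) = p :=
  complementFrom_complementFrom 1 hp.2

theorem complement_eq_self_iff (hp : p ∈ DSPaths n) : complement p = p ↔ pathHeight p ≤ 2 :=
  complementFrom_eq_self_iff odd_one (Nat.zero_le 2) hp.2

variable {σ : Equiv.Perm (Fin (2 * n))}

theorem exists_dsMap_eq_complement (hσ : σ ∈ DPerms n) :
    ∃ τ ∈ DPerms n, dsMap τ = complement (dsMap σ) :=
  (bijOn_dsMap n).surjOn (complement_mem_DSPaths ((bijOn_dsMap n).mapsTo hσ))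

theorem gc_mem_DPerms (hσ : σ ∈ DPerms n) : gc σ ∈ DPerms n :=
  Function.invFunOn_mem (exists_dsMap_eq_complement hσ)

theorem dsMap_gc (hσ : σ ∈ DPerms n) : dsMap (gc σ) = complement (dsMap σ) :=
  Function.invFunOn_eq (exists_dsMap_eq_complement hσ)

theorem gc_gc (hσ : σ ∈ DPerms n) : gc (gc σ) = σ := by
  have hgc := gc_mem_DPerms hσ
  refine (bijOn_dsMap n).injOn (gc_mem_DPerms hgc) hσ ?_
  rw [dsMap_gc hgc, dsMap_gc hσ, complement_complement ((bijOn_dsMap n).mapsTo hσ)]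

theorem gc_eq_self_iff (hσ : σ ∈ DPerms n) : gc σ = σ ↔ pathHeight (dsMap σ) ≤ 2 := by
  rw [← complement_eq_self_iff ((bijOn_dsMap n).mapsTo hσ), ← dsMap_gc hσ]
  exact ((bijOn_dsMap n).injOn.eq_iff (gc_mem_DPerms hσ) hσ).symm

end Complement

/-! ### Fixed points as weights of steps -/

section Weight

variable {M : Type*} [CommMonoid M] (x y : M)

/-- A letter that encodes an even (odd) fixed point, that is, one with a tight label bound, has
weight `x` (`y`). -/
def letterWeight (h : ℤ) (s : Bool × ℕ) : M :=
  if 2 * (s.2 : ℤ) = labelBound h s.1 then (if s.1 then x else y) else 1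

/-- The product of the letter weights of a word that starts at height `h`. -/
def wordWeight : ℤ → List (Bool × ℕ) → M
  | _, [] => 1
  | h, s :: l => letterWeight x y h s * wordWeight (h + slope s.1) l

/-- The letter weight of a rise or a fall; a long level step encodes one even and one odd fixed
point. -/
def stepWeight (h : ℕ) : Step × ℕ → M
  | (.rise, l) => if 2 * l = h + 1 then x else 1
  | (.fall, l) => if 2 * l = h then y else 1
  | (.level, _) => x * y

/-- The product of the step weights of a path that starts at height `h`. -/
def pathWeight : ℕ → LabelledSteps → M
  | _, [] => 1
  | h, s :: p => stepWeight x y h s * pathWeight (s.1.next h) p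

theorem wordWeight_ofFn {N : ℕ} (h : ℤ) (w : Fin N → Bool × ℕ) :
    wordWeight x y h (List.ofFn w) = ∏ k : Fin N, letterWeight x y (h + wordHeight w k) (w k) := by
  induction N generalizing h with
  | zero => simp [wordWeight]
  | succ N ih =>
    simp only [List.ofFn_succ, wordWeight, ih, Fin.prod_univ_succ, Fin.val_zero, Fin.val_succ,
      wordHeight_zero, wordHeight_succ, add_zero, add_assoc]

theorem wordWeight_expand {h : ℕ} {p : LabelledSteps} (hp : IsDSFrom h p) :
    wordWeight x y h (expand p) = pathWeight x y h p := by
  induction p generalizing h with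
  | nil => rfl
  | cons s p ih =>
    obtain ⟨hs, hp⟩ := isDSFrom_cons.1 hp
    rw [pathWeight, ← ih hp]
    obtain ⟨_ | _ | _, l⟩ := s
    · simp only [expand, wordWeight, letterWeight, labelBound, slope, stepWeight, Step.next,
        if_true]
      norm_cast
    · simp only [expand, wordWeight, letterWeight, labelBound, slope, stepWeight, Step.next,
        Nat.cast_sub hs.1, Bool.false_eq_true, if_false, add_zero]
      norm_cast
    · obtain ⟨rfl, rfl⟩ := hs
      simp [expand, wordWeight, letterWeight, labelBound, slope, stepWeight, Step.next,
        mul_left_comm, mul_assoc]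

variable {n : ℕ} {σ : Equiv.Perm (Fin (2 * n))}

theorem letterWeight_word (hσ : IsDPerm σ) (k : Fin (2 * n)) :
    letterWeight x y (wordHeight (word σ) k) (word σ k) =
      (if Even ((k : ℕ) + 1) ∧ σ k = k then x else 1) *
        (if Odd ((k : ℕ) + 1) ∧ σ k = k then y else 1) := by
  change (if 2 * (nestLabel σ k : ℤ) = _ then _ else _) = _
  rw [if_congr (apply_eq_self_iff_two_mul_nestLabel_eq hσ k).symm rfl rfl]
  by_cases hfix : σ k = k
  · have hrise : (word σ k).1 = decide (Even ((k : ℕ) + 1)) := by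
      rw [word, (Equiv.symm_apply_eq σ).2 hfix.symm]
    by_cases heven : Even ((k : ℕ) + 1)
    · simp [hfix, hrise, heven, Nat.not_odd_iff_even.2 heven]
    · simp [hfix, hrise, heven, Nat.not_even_iff_odd.1 heven]
  · simp [hfix]

theorem pathWeight_dsMap (hσ : IsDPerm σ) :
    pathWeight x y 0 (dsMap σ) = x ^ evenFix σ * y ^ oddFix σ := by
  have hword := (bijOn_ofFn (2 * n)).mapsTo (isDWord_word hσ)
  obtain ⟨p, hp, hexpand⟩ := exists_expand_eq (h := 0) hword.2
  have hdsMap : dsMap σ = p := by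
    rw [dsMap_eq_contract, ← hexpand]
    exact contract_expand hp
  rw [hdsMap, ← wordWeight_expand x y hp, hexpand, wordWeight_ofFn]
  simp only [Nat.cast_zero, zero_add, letterWeight_word x y hσ, prod_mul_distrib, prod_ite,
    prod_const, one_pow, mul_one, evenFix, oddFix]

end Weight

/-! ### The generating function of the paths of height at most two -/

section LowPaths

open Classical in
/-- The labelled steps from height `h` that stay at height at most `2`. -/
noncomputable def lowSteps : ℕ → Finset (Step × ℕ)
  | 0 => {(.rise, 0), (.level, 0)}
  | 1 => {(.fall, 0), (.rise, 0), (.rise, 1)}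
  | 2 => {(.fall, 0), (.fall, 1)}
  | _ => ∅

theorem mem_lowSteps {h : ℕ} {s : Step × ℕ} :
    s ∈ lowSteps h ↔ IsLabelledStep h s ∧ h ≤ 2 ∧ s.1.next h ≤ 2 := by
  obtain ⟨_ | _ | _, x⟩ := s <;> rcases h with _ | _ | _ | h <;>
    simp [lowSteps, IsLabelledStep, Step.next] <;> lia

theorem Step.width_pos (s : Step) : 0 < s.width := by
  cases s <;> decide

open Classical in
/-- The labelled 0-Schröder paths of length `m` that start at height `h` and stay at height at most
`2`. -/
noncomputable def lowPaths : ℕ → ℕ → Finset LabelledSteps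
  | 0, h => if h = 0 then {[]} else ∅
  | m + 1, h => {s ∈ lowSteps h | s.1.width ≤ m + 1}.biUnion fun s =>
      (lowPaths (m + 1 - s.1.width) (s.1.next h)).map ⟨List.cons s, List.cons_injective⟩
termination_by m => m
decreasing_by
  have := s.1.width_pos
  lia

theorem nil_mem_lowPaths {m h : ℕ} : [] ∈ lowPaths m h ↔ m = 0 ∧ h = 0 := by
  rcases m with _ | m <;> rw [lowPaths]
  · split_ifs with hh <;> simp [hh]
  · simp

theorem cons_mem_lowPaths {m h : ℕ} {s : Step × ℕ} {p : LabelledSteps} :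
    s :: p ∈ lowPaths m h ↔
      s ∈ lowSteps h ∧ s.1.width ≤ m ∧ p ∈ lowPaths (m - s.1.width) (s.1.next h) := by
  rcases m with _ | m <;> rw [lowPaths]
  · split_ifs <;> simp [s.1.width_pos.ne']
  · simp only [mem_biUnion, mem_filter, mem_map, Function.Embedding.coeFn_mk, List.cons.injEq]
    constructor
    · rintro ⟨s, ⟨hs, hwidth⟩, p, hp, rfl, rfl⟩
      exact ⟨hs, hwidth, hp⟩
    · rintro ⟨hs, hwidth, hp⟩
      exact ⟨s, ⟨hs, hwidth⟩, p, hp, rfl, rfl⟩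

theorem mem_lowPaths {m h : ℕ} {p : LabelledSteps} :
    p ∈ lowPaths m h ↔ pathLength p = m ∧ IsDSFrom h p ∧ maxHeightFrom h p ≤ 2 := by
  induction p generalizing m h with
  | nil =>
    rw [nil_mem_lowPaths]
    simp only [pathLength, List.map_nil, List.sum_nil, IsDSFrom, IsLabelledFrom, maxHeightFrom]
    lia
  | cons s p ih =>
    have hle := le_maxHeightFrom (s.1.next h) p
    rw [cons_mem_lowPaths, mem_lowSteps, ih, isDSFrom_cons, maxHeightFrom, max_le_iff]
    simp only [pathLength, List.map_cons, List.sum_cons]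
    grind

section CommSemiring

variable {R : Type*} [CommSemiring R] (x y : R)

/-- The total weight of `lowPaths m h`. -/
noncomputable def lowSum (m h : ℕ) : R := ∑ p ∈ lowPaths m h, pathWeight x y h p

theorem lowSum_zero (h : ℕ) : lowSum x y 0 h = if h = 0 then 1 else 0 := by
  rw [lowSum, lowPaths]
  split_ifs <;> simp [pathWeight]

theorem lowSum_add_one (m h : ℕ) : lowSum x y (m + 1) h =
    ∑ s ∈ lowSteps h with s.1.width ≤ m + 1,
      stepWeight x y h s * lowSum x y (m + 1 - s.1.width) (s.1.next h) := by
  classical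
  rw [lowSum, lowPaths, sum_biUnion]
  · refine sum_congr rfl fun s _ => ?_
    simp only [sum_map, Function.Embedding.coeFn_mk, pathWeight, lowSum, mul_sum]
  · intro s _ t _ hst
    refine disjoint_left.2 fun p hps hpt => hst ?_
    obtain ⟨q, _, rfl⟩ := mem_map.1 hps
    obtain ⟨r, _, heq⟩ := mem_map.1 hpt
    exact (List.cons.inj heq).1.symm

theorem lowSum_add_two_zero (m : ℕ) :
    lowSum x y (m + 2) 0 = lowSum x y (m + 1) 1 + x * y * lowSum x y m 0 := by
  simp [lowSum_add_one x y (m + 1), sum_filter, lowSteps, stepWeight, Step.width, Step.next]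

theorem lowSum_add_one_one (m : ℕ) :
    lowSum x y (m + 1) 1 = lowSum x y m 0 + (1 + x) * lowSum x y m 2 := by
  simp [lowSum_add_one x y m, sum_filter, lowSteps, stepWeight, Step.width, Step.next, add_mul]

theorem lowSum_add_one_two (m : ℕ) : lowSum x y (m + 1) 2 = (1 + y) * lowSum x y m 1 := by
  simp [lowSum_add_one x y m, sum_filter, lowSteps, stepWeight, Step.width, Step.next, add_mul]

open PowerSeries in
theorem mk_lowSum_zero : PowerSeries.mk (fun n => lowSum x y (2 * n) 0) =
    1 + X * (C (x * y) * PowerSeries.mk (fun n => lowSum x y (2 * n) 0) +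
      PowerSeries.mk (fun n => lowSum x y (2 * n + 1) 1)) := by
  ext n
  rcases n with _ | n
  · simp [lowSum_zero]
  · rw [map_add, coeff_succ_X_mul, map_add, coeff_C_mul, coeff_mk, coeff_mk, coeff_mk, coeff_one,
      if_neg n.succ_ne_zero, mul_add_one, lowSum_add_two_zero]
    ring

open PowerSeries in
theorem mk_lowSum_one : PowerSeries.mk (fun n => lowSum x y (2 * n + 1) 1) =
    PowerSeries.mk (fun n => lowSum x y (2 * n) 0) +
      X * (C ((1 + x) * (1 + y)) * PowerSeries.mk (fun n => lowSum x y (2 * n + 1) 1)) := by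
  ext n
  rcases n with _ | n
  · simp [lowSum_zero, lowSum_add_one_one]
  · rw [map_add, coeff_succ_X_mul, coeff_C_mul, coeff_mk, coeff_mk, coeff_mk, lowSum_add_one_one,
      mul_add, lowSum_add_one_two, mul_assoc]

end CommSemiring

variable {R : Type*} [CommRing R]

theorem eq_recip_of_mul_eq_one {f g : R⟦X⟧} (hfg : g * f = 1)
    (hf : PowerSeries.constantCoeff f = 1) : g = recip f := by
  rw [← mul_one g, ← mul_recip f hf, ← mul_assoc, hfg, one_mul]

open PowerSeries in
theorem mk_lowSum_eq_recip (x y : R) : PowerSeries.mk (fun n => lowSum x y (2 * n) 0) =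
    recip (1 - C (x * y) * X - X * recip (1 - C ((1 + x) * (1 + y)) * X)) := by
  refine eq_recip_of_mul_eq_one ?_ (by simp)
  have hzero := mk_lowSum_zero x y
  have hone := mk_lowSum_one x y
  have hrecip := mul_recip (1 - C ((1 + x) * (1 + y)) * X) (by simp)
  linear_combination hzero + X * (recip (1 - C ((1 + x) * (1 + y)) * X)) * hone
    - X * PowerSeries.mk (fun n => lowSum x y (2 * n + 1) 1) * hrecip

theorem gcPoly_eq_lowSum (n : ℕ) : gcPoly n = lowSum wₑ wₒ (2 * n) 0 := by
  have hfixed {σ : Equiv.Perm (Fin (2 * n))} :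
      σ ∈ gcFixed n ↔ σ ∈ DPerms n ∧ gc σ = σ := by
    simp [gcFixed]
  refine sum_nbij dsMap (fun σ hσ => ?_) ((bijOn_dsMap n).injOn.mono fun σ hσ => (hfixed.1 hσ).1)
    (fun p hp => ?_) fun σ hσ => (pathWeight_dsMap wₑ wₒ (hfixed.1 hσ).1).symm
  · obtain ⟨hD, hgc⟩ := hfixed.1 hσ
    have hpath := (bijOn_dsMap n).mapsTo hD
    exact mem_lowPaths.2 ⟨hpath.1, hpath.2, (gc_eq_self_iff hD).1 hgc⟩
  · obtain ⟨hlength, hDS, hheight⟩ := mem_lowPaths.1 hp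
    obtain ⟨σ, hσ, rfl⟩ := (bijOn_dsMap n).surjOn ⟨hlength, hDS⟩
    exact ⟨σ, hfixed.2 ⟨hσ, (gc_eq_self_iff hσ).2 hheight⟩, rfl⟩

end LowPaths

end GenocchiCorteel

theorem mainTheorem5 :
    -- the Deb–Sokal map is a bijection from D-permutations onto the labelled 0-Schröder paths
    (∀ n : ℕ, Set.BijOn (GenocchiCorteel.dsMap (n := n))
      (GenocchiCorteel.DPerms n) (GenocchiCorteel.DSPaths n)) ∧
    -- the label complement is an involution on the labelled 0-Schröder paths, and its fixed points
    -- are the paths of height at most two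
    (∀ n : ℕ, ∀ p ∈ GenocchiCorteel.DSPaths n,
      GenocchiCorteel.complement p ∈ GenocchiCorteel.DSPaths n ∧
      GenocchiCorteel.complement (GenocchiCorteel.complement p) = p ∧
      (GenocchiCorteel.complement p = p ↔ GenocchiCorteel.pathHeight p ≤ 2)) ∧
    -- the Genocchi–Corteel map is an involution on D-permutations
    (∀ n : ℕ, ∀ σ ∈ GenocchiCorteel.DPerms n,
      GenocchiCorteel.gc σ ∈ GenocchiCorteel.DPerms n ∧
      GenocchiCorteel.gc (GenocchiCorteel.gc σ) = σ) ∧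
    -- the generating function of the fixed points
    PowerSeries.mk GenocchiCorteel.gcPoly =
      GenocchiCorteel.recip
        (1 - PowerSeries.C (GenocchiCorteel.wₑ * GenocchiCorteel.wₒ) * PowerSeries.X
          - PowerSeries.X * GenocchiCorteel.recip
              (1 - PowerSeries.C ((1 + GenocchiCorteel.wₑ) * (1 + GenocchiCorteel.wₒ)) *
                PowerSeries.X)) := by
  refine ⟨GenocchiCorteel.bijOn_dsMap, fun n p hp => ⟨?_, ?_, ?_⟩, fun n σ hσ => ⟨?_, ?_⟩, ?_⟩
  · exact GenocchiCorteel.complement_mem_DSPaths hp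
  · exact GenocchiCorteel.complement_complement hp
  · exact GenocchiCorteel.complement_eq_self_iff hp
  · exact GenocchiCorteel.gc_mem_DPerms hσ
  · exact GenocchiCorteel.gc_gc hσ
  · rw [funext GenocchiCorteel.gcPoly_eq_lowSum]
    exact GenocchiCorteel.mk_lowSum_eq_recip _ _
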